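/- Let $X$ be a compact Hausdorff space, $Y$ a compact metrizable space, and let $f:X\to Y$ be a fully closed surjection, i.e. $f$ is continuous, onto, and $f(A)\cap f(B)$ is finite for any two disjoint closed sets $A,B\subset X$. Suppose that every fibre $f^{-1}(y)$, $y\in Y$, is metrizable. Let $C(X)$ be the space of real-valued continuous functions on $X$ with the supremum norm, and for $h\in C(X)$ and $y\in Y$ put $$\Omega_f(h)(y)=\sup\{h(t)-h(s): s,t\in f^{-1}(y)\},\qquad \operatorname{supp}(\Omega_f(h))=\{y\in Y:\Omega_f(h)(y)\neq 0\}.$$ For $A\subset Y$ let $Z_A$ be the linear subspace $\{h\in C(X):\operatorname{supp}(\Omega_f(h))\subset A\}$ of $C(X)$. Then: 1. $\Omega_f$ maps $C(X)$ into $c_0(Y)$, i.e. for each $h\in C(X)$ and $\varepsilon>0$ the set $\{y\in Y:|\Omega_f(h)(y)|\ge\varepsilon\}$ is finite; 2. $Z_A$ is separable for every countable (in particular, every finite) $A\subset Y$; 3. (a) $Z_A\subset Z_B$ whenever $A\subset B\subset Y$; 4. (b) for every $h\in C(X)$ and every sequence $K_1\subset K_2\subset\cdots$ of finite subsets of $Y$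 with $\operatorname{supp}(\Omega_f(h))\subset\bigcup_n K_n$, the function $h$ belongs to the norm closure of the linear span of $\bigcup_n Z_{K_n}$. -/

import Mathlib

open Filter Topology Set
open scoped ENNReal

noncomputable section

namespace FullyClosed

/-- A map is fully closed if it is continuous and the images of any two disjoint closed sets
have finite intersection. (Used for maps between compact Hausdorff spaces.) -/
structure IsFullyClosedMap {X Y : Type*} [TopologicalSpace X] [TopologicalSpace Y]
    (f : X → Y) : Prop where
  continuous : Continuous f
  finite_inter : ∀ A B : Set X, IsClosed A → IsClosed B → Disjoint A B →
    (f '' A ∩ f '' B).Finite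

/-- The space `c₀(Γ)` of real functions on the set `Γ` vanishing at infinity, as a subspace
of `ℓ_∞(Γ)`. -/
def c0 (Γ : Type*) : Submodule ℝ (lp (fun _ : Γ => ℝ) ∞) where
  carrier := {x | Tendsto (fun γ => x γ) cofinite (𝓝 0)}
  zero_mem' := by
    simp only [Set.mem_setOf_eq, lp.coeFn_zero, Pi.zero_apply]
    exact tendsto_const_nhds
  add_mem' := by
    intro x y hx hy
    simp only [Set.mem_setOf_eq, lp.coeFn_add, Pi.add_apply] at *
    simpa using hx.add hy
  smul_mem' := by
    intro c x hx
    simp only [Set.mem_setOf_eq, lp.coeFn_smul, Pi.smul_apply] at *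
    simpa using hx.const_smul c

variable {X Y : Type*} [TopologicalSpace X]

/-- The oscillation `sup {h t - h s : s, t ∈ f⁻¹(y)}` of `h` on the fibre of `f` over `y`. -/
def osc (f : X → Y) (h : C(X, ℝ)) (y : Y) : ℝ :=
  ⨆ p : (f ⁻¹' {y}) × (f ⁻¹' {y}), (h p.1 - h p.2)

theorem sub_le_two_norm [CompactSpace X] (h : C(X, ℝ)) (t s : X) : h t - h s ≤ 2 * ‖h‖ := by
  have h1 := (abs_le.1 (h.norm_coe_le_norm t)).2
  have h2 := (abs_le.1 (h.norm_coe_le_norm s)).1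
  linarith

theorem osc_bddAbove [CompactSpace X] (f : X → Y) (h : C(X, ℝ)) (y : Y) :
    BddAbove (Set.range fun p : (f ⁻¹' {y}) × (f ⁻¹' {y}) => h p.1 - h p.2) :=
  ⟨2 * ‖h‖, by rintro _ ⟨p, rfl⟩; exact sub_le_two_norm h _ _⟩

theorem osc_nonneg [CompactSpace X] (f : X → Y) (h : C(X, ℝ)) (y : Y) : 0 ≤ osc f h y := by
  rcases isEmpty_or_nonempty (f ⁻¹' {y}) with he | ⟨⟨x⟩⟩
  · exact (Real.iSup_of_isEmpty _).ge
  · exact le_ciSup_of_le (osc_bddAbove f h y) (x, x) (by simp)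

theorem osc_le [CompactSpace X] (f : X → Y) (h : C(X, ℝ)) (y : Y) : osc f h y ≤ 2 * ‖h‖ :=
  Real.iSup_le (fun _ => sub_le_two_norm h _ _) (by positivity)

theorem osc_eq_zero_iff [CompactSpace X] (f : X → Y) (h : C(X, ℝ)) (y : Y) :
    osc f h y = 0 ↔ ∀ s t : X, f s = y → f t = y → h s = h t := by
  constructor
  · intro h0 s t hs ht
    have h1 : h s - h t ≤ osc f h y :=
      le_ciSup (osc_bddAbove f h y) ((⟨s, hs⟩, ⟨t, ht⟩) : (f ⁻¹' {y}) × (f ⁻¹' {y}))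
    have h2 : h t - h s ≤ osc f h y :=
      le_ciSup (osc_bddAbove f h y) ((⟨t, ht⟩, ⟨s, hs⟩) : (f ⁻¹' {y}) × (f ⁻¹' {y}))
    linarith
  · intro hc
    refine le_antisymm (Real.iSup_le (fun p => ?_) le_rfl) (osc_nonneg f h y)
    rw [hc p.1 p.2 p.1.2 p.2.2, sub_self]

/-- The fibrewise oscillation map `Ω_f : C(X) → ℓ_∞(Y)`, `Ω_f(h)(y) = osc_{f⁻¹(y)}(h)`. -/
def fiberOsc [CompactSpace X] (f : X → Y) (h : C(X, ℝ)) : lp (fun _ : Y => ℝ) ∞ :=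
  ⟨osc f h, memℓp_infty ⟨2 * ‖h‖, by
    rintro _ ⟨y, rfl⟩
    simpa only [Real.norm_eq_abs, abs_of_nonneg (osc_nonneg f h y)] using osc_le f h y⟩⟩

/-- The subspace `Z_A` of all `h ∈ C(X)` such that the support of `Ω_f(h)` is contained
in `A`. -/
def Z [CompactSpace X] (f : X → Y) (A : Set Y) : Submodule ℝ C(X, ℝ) where
  carrier := {h | Function.support (fun y => fiberOsc f h y) ⊆ A}
  zero_mem' := by
    intro y hy
    exact absurd ((osc_eq_zero_iff f 0 y).2 fun _ _ _ _ => rfl) hy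
  add_mem' := by
    intro g h hg hh y hy
    by_contra hA
    have h1 := (osc_eq_zero_iff f g y).1 (Function.notMem_support.1 fun h' => hA (hg h'))
    have h2 := (osc_eq_zero_iff f h y).1 (Function.notMem_support.1 fun h' => hA (hh h'))
    refine hy ((osc_eq_zero_iff f (g + h) y).2 fun s t hs ht => ?_)
    simp [h1 s t hs ht, h2 s t hs ht]
  smul_mem' := by
    intro c h hh y hy
    by_contra hA
    have h2 := (osc_eq_zero_iff f h y).1 (Function.notMem_support.1 fun h' => hA (hh h'))
    refine hy ((osc_eq_zero_iff f (c • h) y).2 fun s t hs ht => ?_)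
    simp [h2 s t hs ht]

end FullyClosed

end

namespace FullyClosed

/-! Full closedness enters twice. Slicing the range of `h` into bands gives finitely many fibres of
oscillation at least `ε` (`finite_osc_ge`). It also makes `collapse f F` a closed relation for every
`F` (`isClosed_collapse`), so the quotient is compact Hausdorff and a partition of unity there moves
`h` by at most `ε` into `Z f F`, where `F` contains the large-oscillation points
(`exists_mem_Z_dist_le`). Density in (b) follows, and separability for countable `A` reduces to
finite `A`. For finite `K`, restriction to the metrizable fibres over `K` has separable range, and
what restriction loses is controlled by the separable space `C(Y, ℝ)`. -/

theorem mem_Z_iff {X Y : Type*} [TopologicalSpace X] [CompactSpace X] {f : X → Y} {A : Set Y}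
    {h : C(X, ℝ)} : h ∈ Z f A ↔ ∀ s t, f s = f t → f s ∉ A → h s = h t := by
  constructor
  · intro hh s t hst hA
    exact (osc_eq_zero_iff f h (f s)).1 (Function.notMem_support.1 fun h' => hA (hh h'))
      s t rfl hst.symm
  · intro hh y hy
    by_contra hA
    refine hy ((osc_eq_zero_iff f h y).2 fun s t hs ht => ?_)
    exact hh s t (hs.trans ht.symm) (hs ▸ hA)

theorem Z_mono {X Y : Type*} [TopologicalSpace X] [CompactSpace X] (f : X → Y) {A B : Set Y}
    (h : A ⊆ B) : Z f A ≤ Z f B := fun _ hg => Set.Subset.trans hg h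

theorem sub_le_osc {X Y : Type*} [TopologicalSpace X] [CompactSpace X] (f : X → Y)
    (h : C(X, ℝ)) {s t : X} (hst : f s = f t) : h s - h t ≤ osc f h (f t) :=
  le_ciSup (osc_bddAbove f h (f t)) ((⟨s, hst⟩, ⟨t, rfl⟩) : (f ⁻¹' {f t}) × (f ⁻¹' {f t}))

/-- Only finitely many fibres of a fully closed map carry a large oscillation. -/
theorem finite_osc_ge {X Y : Type*} [TopologicalSpace X] [CompactSpace X] [TopologicalSpace Y]
    {f : X → Y} (hf : IsFullyClosedMap f) (h : C(X, ℝ)) {ε : ℝ} (hε : 0 < ε) :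
    {y | ε ≤ osc f h y}.Finite := by
  -- With `k = ⌈h s / δ⌉`, `(k + 1) * δ < h s + 2 * δ = h s + ε / 2`, so a gap above `ε / 2` jumps a
  -- whole band.
  set δ := ε / 4 with hδ
  have hδ0 : 0 < δ := by positivity
  set N : ℤ := ⌈‖h‖ / δ⌉ + 1 with hN
  have hfin : (⋃ k ∈ Set.Icc (-N) N,
      (f '' {x | h x ≤ k * δ} ∩ f '' {x | (k + 1) * δ ≤ h x})).Finite := by
    refine (Set.finite_Icc _ _).biUnion fun k _ => hf.finite_inter _ _
      (isClosed_le h.continuous continuous_const) (isClosed_le continuous_const h.continuous) ?_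
    refine Set.disjoint_left.2 fun x hx hx' => ?_
    simp only [Set.mem_ofPred_eq] at hx hx'
    linarith
  refine hfin.subset fun y hy => ?_
  have hy' : ε ≤ osc f h y := hy
  obtain ⟨⟨⟨t, ht⟩, ⟨s, hs⟩⟩, hp⟩ : ∃ p : (f ⁻¹' {y}) × (f ⁻¹' {y}), ε / 2 < h p.1 - h p.2 := by
    by_contra! hc
    have : osc f h y ≤ ε / 2 := Real.iSup_le hc (by positivity)
    linarith
  have ht' : f t = y := ht
  have hs' : f s = y := hs
  have hp' : ε / 2 < h t - h s := hp
  have hb := abs_le.1 (h.norm_coe_le_norm s)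
  have hc1 : h s ≤ ⌈h s / δ⌉ * δ := (div_le_iff₀ hδ0).1 (Int.le_ceil _)
  have hc2 : ⌈h s / δ⌉ * δ < h s + δ := by
    have := mul_lt_mul_of_pos_right (Int.ceil_lt_add_one (h s / δ)) hδ0
    rwa [add_mul, div_mul_cancel₀ _ hδ0.ne', one_mul] at this
  simp only [Set.mem_iUnion]
  refine ⟨⌈h s / δ⌉, ⟨?_, ?_⟩, ⟨s, hc1, hs'⟩, ⟨t, ?_, ht'⟩⟩
  · have h1 : -(‖h‖ / δ) ≤ h s / δ := by
      rw [← neg_div]; exact div_le_div_of_nonneg_right hb.1 hδ0.le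
    have h2 : ((-N : ℤ) : ℝ) ≤ ⌈h s / δ⌉ := by
      have := Int.le_ceil (‖h‖ / δ)
      have := Int.le_ceil (h s / δ)
      push_cast [hN]
      linarith
    exact_mod_cast h2
  · have : ⌈h s / δ⌉ ≤ ⌈‖h‖ / δ⌉ := Int.ceil_le_ceil (div_le_div_of_nonneg_right hb.2 hδ0.le)
    omega
  · simp only [Set.mem_ofPred_eq]
    linarith

theorem fiberOsc_mem_c0 {X Y : Type*} [TopologicalSpace X] [CompactSpace X] [TopologicalSpace Y]
    {f : X → Y} (hf : IsFullyClosedMap f) (h : C(X, ℝ)) : fiberOsc f h ∈ c0 Y := by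
  change Tendsto (fun y => osc f h y) cofinite (𝓝 0)
  refine Metric.tendsto_nhds.2 fun ε hε => ?_
  refine (finite_osc_ge hf h hε).subset fun y hy => ?_
  have : ¬ dist (osc f h y) 0 < ε := hy
  rwa [Real.dist_eq, sub_zero, abs_of_nonneg (osc_nonneg f h y), not_lt] at this

/-- The equivalence relation collapsing the fibres of `f` over the points outside `F`. -/
def collapse {X Y : Type*} (f : X → Y) (F : Set Y) : Setoid X where
  r x x' := x = x' ∨ f x = f x' ∧ f x ∉ F
  iseqv := by
    refine ⟨fun x => Or.inl rfl, ?_, ?_⟩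
    · rintro x y (rfl | ⟨h, h'⟩)
      · exact Or.inl rfl
      · exact Or.inr ⟨h.symm, h ▸ h'⟩
    · rintro x y z (rfl | ⟨h, h'⟩) (rfl | ⟨k, k'⟩)
      · exact Or.inl rfl
      · exact Or.inr ⟨k, k'⟩
      · exact Or.inr ⟨h, h'⟩
      · exact Or.inr ⟨h.trans k, h'⟩

theorem isClosed_collapse {X Y : Type*} [TopologicalSpace X] [CompactSpace X] [T2Space X]
    [TopologicalSpace Y] [T2Space Y] {f : X → Y} (hf : IsFullyClosedMap f) (F : Set Y) :
    IsClosed {p : X × X | collapse f F p.1 p.2} := by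
  rw [← isOpen_compl_iff, isOpen_iff_mem_nhds]
  rintro ⟨x, x'⟩ hx
  have hx1 : ¬ (x = x' ∨ f x = f x' ∧ f x ∉ F) := hx
  push Not at hx1
  obtain ⟨hne, hF⟩ := hx1
  by_cases hfx : f x = f x'
  · obtain ⟨U₀, hU₀, V₀, hV₀, hUV₀⟩ := exists_nhds_disjoint_closure hne
    obtain ⟨U, V, hU, hV, hUc, hVc, hUV⟩ :
        ∃ U V, U ∈ 𝓝 x ∧ V ∈ 𝓝 x' ∧ IsClosed U ∧ IsClosed V ∧ Disjoint U V :=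
      ⟨_, _, mem_of_superset hU₀ subset_closure, mem_of_superset hV₀ subset_closure,
        isClosed_closure, isClosed_closure, hUV₀⟩
    have hfin := (hf.finite_inter U V hUc hVc hUV).subset (Set.sdiff_subset (t := {f x}))
    -- Near `x`, avoid the finitely many common values other than `f x`; the value `f x` itself lies
    -- in `F`, hence is not collapsed.
    have hW : f ⁻¹' ((f '' U ∩ f '' V) \ {f x})ᶜ ∈ 𝓝 x :=
      (hfin.isClosed.isOpen_compl.preimage hf.continuous).mem_nhds (by simp)
    filter_upwards [prod_mem_nhds (inter_mem hU hW) hV]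
    rintro ⟨u, v⟩ ⟨⟨huU, huW⟩, hv⟩ (h | ⟨h, h'⟩)
    · exact Set.disjoint_left.1 hUV huU ((show u = v from h) ▸ hv)
    · refine huW ⟨⟨⟨u, huU, rfl⟩, ⟨v, hv, h.symm⟩⟩, fun h'' => h' ?_⟩
      rw [show f u = f x from h'']
      exact hF hfx
  · have : {p : X × X | f p.1 ≠ f p.2} ∈ 𝓝 (x, x') :=
      (isOpen_ne_fun (hf.continuous.comp continuous_fst)
        (hf.continuous.comp continuous_snd)).mem_nhds hfx
    filter_upwards [this]
    rintro ⟨u, v⟩ huv (h | ⟨h, -⟩)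
    · exact huv (congrArg f h)
    · exact huv h

theorem isClosedMap_quotient_mk {X : Type*} [TopologicalSpace X] [CompactSpace X] {s : Setoid X}
    (hs : IsClosed {p : X × X | s p.1 p.2}) : IsClosedMap (Quotient.mk s) := by
  intro C hC
  rw [← isQuotientMap_quotient_mk'.isClosed_preimage]
  -- The saturation of `C` is a projection of a closed set along a compact factor.
  convert isClosedMap_snd_of_compactSpace _ (hs.inter (hC.preimage continuous_fst)) using 1
  ext x
  constructor
  · rintro ⟨c, hc, hcx⟩
    exact ⟨(c, x), ⟨Quotient.exact hcx, hc⟩, rfl⟩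
  · rintro ⟨⟨c, x'⟩, ⟨h, hc⟩, rfl⟩
    exact ⟨c, hc, Quotient.sound h⟩

theorem normalSpace_of_isClosedMap {X Q : Type*} [TopologicalSpace X] [NormalSpace X]
    [TopologicalSpace Q] {p : X → Q} (hc : Continuous p) (hp : IsClosedMap p)
    (hs : Function.Surjective p) : NormalSpace Q := by
  refine ⟨fun A B hA hB hAB => ?_⟩
  obtain ⟨U, V, hU, hV, hAU, hBV, hUV⟩ :=
    normal_separation (hA.preimage hc) (hB.preimage hc) (hAB.preimage p)
  refine ⟨(p '' Uᶜ)ᶜ, (p '' Vᶜ)ᶜ, (hp _ hU.isClosed_compl).isOpen_compl,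
    (hp _ hV.isClosed_compl).isOpen_compl, ?_, ?_, ?_⟩
  · rintro _ ha ⟨x, hx, rfl⟩
    exact hx (hAU ha)
  · rintro _ hb ⟨x, hx, rfl⟩
    exact hx (hBV hb)
  · refine Set.disjoint_left.2 fun q hqU hqV => ?_
    obtain ⟨x, rfl⟩ := hs q
    have h1 : x ∈ U := by_contra fun h => hqU ⟨x, h, rfl⟩
    have h2 : x ∈ V := by_contra fun h => hqV ⟨x, h, rfl⟩
    exact Set.disjoint_left.1 hUV h1 h2

/-- A continuous function with small oscillation on the classes of a closed equivalence relation
is uniformly close to one that is constant on the classes. -/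
theorem exists_quotient_approx {X : Type*} [TopologicalSpace X] [CompactSpace X] [T2Space X]
    {s : Setoid X} (hs : IsClosed {p : X × X | s p.1 p.2}) (h : C(X, ℝ)) {ε : ℝ}
    (hε : ∀ x x', s x x' → |h x - h x'| < ε) :
    ∃ g : C(Quotient s, ℝ), ∀ x, |h x - g (Quotient.mk s x)| < ε := by
  have hcl := isClosedMap_quotient_mk hs
  have hcont : Continuous (Quotient.mk s) := continuous_quotient_mk'
  have hsurj : Function.Surjective (Quotient.mk s) := Quotient.mk_surjective
  have : NormalSpace (Quotient s) := normalSpace_of_isClosedMap hcont hcl hsurj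
  have : T1Space (Quotient s) := ⟨fun q => by
    obtain ⟨x, rfl⟩ := hsurj q
    simpa using hcl _ (isClosed_singleton (x := x))⟩
  have : T4Space (Quotient s) := {}
  obtain ⟨g, hg⟩ := exists_continuous_forall_mem_convex_of_local_const
    (t := fun q : Quotient s => {c : ℝ | ∀ x, Quotient.mk s x = q → c ∈ Metric.ball (h x) ε})
    (fun q => by
      have : {c : ℝ | ∀ x, Quotient.mk s x = q → c ∈ Metric.ball (h x) ε} =
          ⋂ x, ⋂ (_ : Quotient.mk s x = q), Metric.ball (h x) ε := by ext; simp
      rw [this]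
      exact convex_iInter₂ fun x _ => convex_ball _ _)
    (fun q => by
      obtain ⟨x₀, rfl⟩ := hsurj q
      -- Since the projection is closed, an estimate near a whole class holds over a neighbourhood
      -- of its image.
      refine ⟨h x₀, hcl.eventually_nhds_fiber _ fun x hx => ?_⟩
      have h1 : |h x₀ - h x| < ε := hε _ _ (Quotient.exact (Eq.symm hx))
      exact ((continuous_const.sub h.continuous).abs.continuousAt.eventually_lt
        continuousAt_const h1))
  refine ⟨g, fun x => ?_⟩
  have := hg (Quotient.mk s x) x rfl
  rw [Metric.mem_ball, Real.dist_eq] at this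
  rwa [abs_sub_comm]

theorem exists_mem_Z_dist_le {X Y : Type*} [TopologicalSpace X] [CompactSpace X] [T2Space X]
    [TopologicalSpace Y] [T2Space Y] {f : X → Y} (hf : IsFullyClosedMap f) (F : Set Y)
    (h : C(X, ℝ)) {ε : ℝ} (hε : 0 < ε) (hF : {y | ε ≤ osc f h y} ⊆ F) :
    ∃ g ∈ Z f F, dist h g ≤ ε := by
  obtain ⟨g, hg⟩ := exists_quotient_approx (isClosed_collapse hf F) h (ε := ε) (by
    rintro x x' (rfl | ⟨hx, hxF⟩)
    · simpa using hε
    · have h0 : osc f h (f x) < ε := not_le.1 fun h' => hxF (hF h')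
      have h1 := sub_le_osc f h hx
      have h2 := sub_le_osc f h hx.symm
      rw [← hx] at h1
      exact abs_lt.2 ⟨by linarith, by linarith⟩)
  refine ⟨g.comp ⟨Quotient.mk (collapse f F), continuous_quotient_mk'⟩, mem_Z_iff.2 ?_, ?_⟩
  · intro s t hst hs
    exact congrArg g (Quotient.sound (Or.inr ⟨hst, hs⟩))
  · exact (ContinuousMap.dist_le hε.le).2 fun x => (hg x).le

theorem exists_comp_eq {X Y : Type*} [TopologicalSpace X] [CompactSpace X]
    [TopologicalSpace Y] [T2Space Y] {f : X → Y} (hf : Continuous f)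
    (hsurj : Function.Surjective f) (h : C(X, ℝ)) (hh : ∀ s t, f s = f t → h s = h t) :
    ∃ g : C(Y, ℝ), h = g.comp ⟨f, hf⟩ := by
  have hq : IsQuotientMap f := hf.isClosedMap.isQuotientMap hf hsurj
  refine ⟨⟨fun y => h (Function.surjInv hsurj y), hq.continuous_iff.2 ?_⟩, ?_⟩
  · convert h.continuous using 1
    funext x
    exact hh _ _ (Function.surjInv_eq hsurj (f x))
  · ext x
    exact hh _ _ (Function.surjInv_eq hsurj (f x)).symm

/-- A function in `Z f K` that is small on the fibres over `K` is uniformly close to a function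
that factors through `f`. -/
theorem exists_dist_comp_le {X Y : Type*} [TopologicalSpace X] [CompactSpace X]
    [TopologicalSpace Y] [T2Space Y] {f : X → Y} (hf : Continuous f)
    (hsurj : Function.Surjective f) {K : Set Y} {u : C(X, ℝ)} (hu : u ∈ Z f K) {δ : ℝ}
    (hδ : 0 ≤ δ) (hK : ∀ x, f x ∈ K → |u x| ≤ δ) :
    ∃ g : C(Y, ℝ), dist u (g.comp ⟨f, hf⟩) ≤ δ := by
  -- Clamping changes nothing over `K`, so `u - v` vanishes there and is constant on all fibres.
  let v : C(X, ℝ) := ⟨fun x => max (-δ) (min δ (u x)), by fun_prop⟩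
  obtain ⟨g, hg⟩ := exists_comp_eq hf hsurj (u - v) (by
    intro s t hst
    change u s - max (-δ) (min δ (u s)) = u t - max (-δ) (min δ (u t))
    by_cases hs : f s ∈ K
    · have h1 := abs_le.1 (hK s hs)
      have h2 := abs_le.1 (hK t (hst ▸ hs))
      rw [min_eq_right h1.2, min_eq_right h2.2, max_eq_right h1.1, max_eq_right h2.1,
        sub_self, sub_self]
    · rw [mem_Z_iff.1 hu s t hst hs])
  refine ⟨g, ?_⟩
  rw [← hg, dist_eq_norm, sub_sub_cancel]
  refine (ContinuousMap.norm_le _ hδ).2 fun x => abs_le.2 ⟨le_max_left _ _, ?_⟩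
  exact max_le (by linarith) (min_le_left _ _)

theorem isSeparable_Z_of_finite {X Y : Type*} [TopologicalSpace X] [CompactSpace X] [T2Space X]
    [TopologicalSpace Y] [CompactSpace Y] [TopologicalSpace.MetrizableSpace Y] {f : X → Y}
    (hf : Continuous f) (hsurj : Function.Surjective f) {K : Set Y} (hK : K.Finite)
    (hfib : ∀ y ∈ K, TopologicalSpace.MetrizableSpace (f ⁻¹' {y})) :
    TopologicalSpace.IsSeparable (Z f K : Set C(X, ℝ)) := by
  have := hK.fintype
  have hcomp (y : K) : CompactSpace (f ⁻¹' {y.1}) :=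
    isCompact_iff_compactSpace.1 (isClosed_singleton.preimage hf).isCompact
  have hmet (y : K) : TopologicalSpace.MetrizableSpace (f ⁻¹' {y.1}) := hfib y.1 y.2
  have hsc (y : K) : SecondCountableTopology (f ⁻¹' {y.1}) := by
    let _ := TopologicalSpace.metrizableSpaceMetric (f ⁻¹' {y.1})
    infer_instance
  have hscY : SecondCountableTopology Y := by
    let _ := TopologicalSpace.metrizableSpaceMetric Y
    infer_instance
  let r : C(X, ℝ) → ∀ y : K, C(f ⁻¹' {y.1}, ℝ) := fun h y => h.restrict _
  obtain ⟨c, hcs, hcc, hcd⟩ :=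
    (TopologicalSpace.IsSeparable.of_separableSpace (r '' (Z f K))).exists_countable_dense_subset
  have : Countable c := hcc
  -- Lifts of a countable dense set of restrictions: `h` minus a suitable lift is small over `K`,
  -- hence close to some `g ∘ f`.
  choose d hdZ hdr using fun p : c => hcs p.2
  have hsep : TopologicalSpace.IsSeparable
      (⋃ p : c, Set.range fun g : C(Y, ℝ) => d p + g.comp ⟨f, hf⟩) :=
    .iUnion fun p => TopologicalSpace.isSeparable_range
      (continuous_const.add (ContinuousMap.continuous_precomp _))
  refine hsep.closure.mono fun h hh => Metric.mem_closure_iff.2 fun ε hε => ?_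
  obtain ⟨_, hp, hd⟩ := Metric.mem_closure_iff.1 (hcd (Set.mem_image_of_mem r hh)) _ (half_pos hε)
  obtain ⟨g, hg⟩ := exists_dist_comp_le hf hsurj ((Z f K).sub_mem hh (hdZ ⟨_, hp⟩))
    (half_pos hε).le (fun x hx => by
      replace hd : dist (r h) (r (d ⟨_, hp⟩)) < ε / 2 := by rwa [hdr]
      have h1 := (dist_le_pi_dist _ _ (⟨f x, hx⟩ : K)).trans hd.le
      have := hcomp ⟨f x, hx⟩
      exact (ContinuousMap.dist_apply_le_dist (⟨x, rfl⟩ : f ⁻¹' {f x})).trans h1)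
  refine ⟨_, Set.mem_iUnion.2 ⟨⟨_, hp⟩, g, rfl⟩, ?_⟩
  rw [dist_eq_norm] at hg ⊢
  rw [← sub_sub]
  linarith

theorem isSeparable_Z_of_countable {X Y : Type*} [TopologicalSpace X] [CompactSpace X] [T2Space X]
    [TopologicalSpace Y] [CompactSpace Y] [TopologicalSpace.MetrizableSpace Y] {f : X → Y}
    (hf : IsFullyClosedMap f) (hsurj : Function.Surjective f) {A : Set Y} (hA : A.Countable)
    (hfib : ∀ y ∈ A, TopologicalSpace.MetrizableSpace (f ⁻¹' {y})) :
    TopologicalSpace.IsSeparable (Z f A : Set C(X, ℝ)) := by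
  have hc : {K : Set Y | K.Finite ∧ K ⊆ A}.Countable := Set.countable_ofPred_finite_subset hA
  have : Countable {K : Set Y | K.Finite ∧ K ⊆ A} := hc
  have hsep : TopologicalSpace.IsSeparable
      (⋃ K : {K : Set Y | K.Finite ∧ K ⊆ A}, (Z f K.1 : Set C(X, ℝ))) :=
    .iUnion fun K => isSeparable_Z_of_finite hf.continuous hsurj K.2.1
      fun y hy => hfib y (K.2.2 hy)
  refine hsep.closure.mono fun h hh => Metric.mem_closure_iff.2 fun ε hε => ?_
  -- This finite set serves as `K`; a countable `A` has only countably many finite subsets.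
  have hsub : {y | ε / 2 ≤ osc f h y} ⊆ A := fun y hy =>
    hh (show osc f h y ≠ 0 from ((half_pos hε).trans_le hy).ne')
  obtain ⟨g, hg, hd⟩ := exists_mem_Z_dist_le hf _ h (half_pos hε) subset_rfl
  exact ⟨g, Set.mem_iUnion.2 ⟨⟨_, finite_osc_ge hf h (half_pos hε), hsub⟩, hg⟩, by linarith⟩

theorem mem_closure_span_iUnion_Z {X Y : Type*} [TopologicalSpace X] [CompactSpace X] [T2Space X]
    [TopologicalSpace Y] [T2Space Y] {f : X → Y} (hf : IsFullyClosedMap f) (h : C(X, ℝ))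
    {K : ℕ → Set Y} (hK : Monotone K)
    (hsupp : Function.support (fun y => fiberOsc f h y) ⊆ ⋃ n, K n) :
    h ∈ closure (Submodule.span ℝ (⋃ n, (Z f (K n) : Set C(X, ℝ))) : Set C(X, ℝ)) := by
  refine Metric.mem_closure_iff.2 fun ε hε => ?_
  have hfin := finite_osc_ge hf h (half_pos hε)
  have hsub : {y | ε / 2 ≤ osc f h y} ⊆ ⋃ n, K n := fun y hy =>
    hsupp (show osc f h y ≠ 0 from ((half_pos hε).trans_le hy).ne')
  obtain ⟨I, hI, hIs⟩ := Set.finite_subset_iUnion hfin hsub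
  obtain ⟨n, hnI⟩ := hI.bddAbove
  have hn : {y | ε / 2 ≤ osc f h y} ⊆ K n := hIs.trans (Set.iUnion₂_subset fun i hi => hK (hnI hi))
  obtain ⟨g, hg, hd⟩ := exists_mem_Z_dist_le hf _ h (half_pos hε) hn
  exact ⟨g, Submodule.subset_span (Set.mem_iUnion.2 ⟨n, hg⟩), by linarith⟩

end FullyClosed

theorem proposition3p5 {X Y : Type*}
    [TopologicalSpace X] [CompactSpace X] [T2Space X]
    [TopologicalSpace Y] [CompactSpace Y] [TopologicalSpace.MetrizableSpace Y]
    (f : X → Y) (hf : FullyClosed.IsFullyClosedMap f) (hsurj : Function.Surjective f)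
    (hfib : ∀ y : Y, TopologicalSpace.MetrizableSpace (f ⁻¹' {y})) :
    (∀ h : C(X, ℝ), FullyClosed.fiberOsc f h ∈ FullyClosed.c0 Y) ∧
    (∀ A : Set Y, A.Countable →
      TopologicalSpace.IsSeparable (FullyClosed.Z f A : Set C(X, ℝ))) ∧
    (∀ A B : Set Y, A ⊆ B → FullyClosed.Z f A ≤ FullyClosed.Z f B) ∧
    (∀ (h : C(X, ℝ)) (K : ℕ → Set Y), (∀ n, (K n).Finite) → Monotone K →
      Function.support (fun y => FullyClosed.fiberOsc f h y) ⊆ ⋃ n, K n →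
      h ∈ closure
        (Submodule.span ℝ (⋃ n, (FullyClosed.Z f (K n) : Set C(X, ℝ))) : Set C(X, ℝ))) := by
  refine ⟨FullyClosed.fiberOsc_mem_c0 hf, fun A hA => ?_, fun A B => FullyClosed.Z_mono f, ?_⟩
  · exact FullyClosed.isSeparable_Z_of_countable hf hsurj hA fun y _ => hfib y
  · intro h K _ hK hsupp
    exact FullyClosed.mem_closure_span_iUnion_Z hf h hK hsupp
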